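/- Let $\mathcal{E}$ be an elementary topos with chosen finite products, and let $(\Sigma,E)$ be a finitary single-sorted algebraic signature $\Sigma$ with a set $E$ of equations between $\Sigma$-terms. A $(\Sigma,E)$-algebra in $\mathcal{E}$ is an object $A$ with morphisms $\sigma : A^n \to A$ for each $n$-ary $\sigma \in \Sigma$ satisfying the equations. An internal partially ordered commutative monoid $(Q,\otimes,k,\le)$ in $\mathcal{E}$ is an internal commutative monoid $(Q,\otimes,k)$ with an internal partial order ${\le} \hookrightarrow Q \times Q$ for which $\otimes$ is monotone; a morphism of such is a monotone monoid morphism. A $Q$-span $(X,f,g,\chi)$ from $A$ to $B$ consists of morphisms $f : X \to A$, $g : X \to B$, $\chi : X \to Q$ of $\mathcal{E}$; two are isomorphic if an isomorphism of apices commutes with all three morphisms. For $(\Sigma,E)$-algebras $A, B$ a $Q$-span is algebraic if, in the internal language of $\mathcal{E}$, for every $n$-ary $\sigma \in \Sigma$, whenever $f(x_i) = a_i$ and $g(x_i) = b_i$ for $1 \le i \le n$, there exists $x$ with $f(x) = \sigma(a_1,\dots,a_n)$, $g(x) = \sigma(b_1,\dots,b_n)$ and $\chi(x_1) \otimes \dots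 \otimes \chi(x_n) \le \chi(x)$. Let $\mathbf{Span}_{(\Sigma,E)}(Q)$ be the following preordered symmetric monoidal category. Objects are $(\Sigma,E)$-algebras, and morphisms are isomorphism classes of algebraic $Q$-spans. The identity on $A$ is $(A,1,1,\chi_k)$, where $\chi_k : A \to 1 \xrightarrow{k} Q$. The composite of $(X,f,g,\chi) : A \to B$ and $(Y,f',g',\xi) : B \to C$ is $(X \times_B Y,\, f p_1,\, g' p_2,\, \otimes \circ (\chi \times \xi) \circ \langle p_1,p_2\rangle)$, with $p_1,p_2$ the pullback projections. The monoidal structure is the product of algebras on objects, the terminal algebra as unit, and $(X,f,g,\chi) \otimes (X',f',g',\chi') = (X \times X', f \times f', g \times g', \otimes \circ (\chi \times \chi'))$ on morphisms, and its coherence isomorphisms and symmetry are the graphs $(A,1,c,\chi_k)$ of those, $c$, of the finite products. The preorder on morphisms is $(X_1,f_1,g_1,\chi_1) \subseteq (X_2,f_2,g_2,\chi_2)$ iff there is a monomorphism $m : X_1 \to X_2$ with $f_1 = f_2 m$, $g_1 = g_2 m$ and $\chi_1(x) \le \chi_2(m(x))$ for all $x$ internally. **Theorem.** Every morphism $h :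 Q_1 \to Q_2$ of internal partially ordered commutative monoids in $\mathcal{E}$ induces, by postcomposition $[(X,f,g,\chi)] \mapsto [(X,f,g,h \circ \chi)]$, an identity-on-objects strict symmetric monoidal $\mathbf{Preord}$-functor $$h^* : \mathbf{Span}_{(\Sigma,E)}(Q_1) \to \mathbf{Span}_{(\Sigma,E)}(Q_2)$$ (that is, a functor which is monotone on hom-preorders and preserves the unit, the tensor product, the coherence isomorphisms and the symmetry on the nose). The assignment $h \mapsto h^*$ is functorial: $(1_Q)^* = \mathrm{Id}$ and $(g \circ h)^* = g^* \circ h^*$ for all $h : Q_1 \to Q_2$ and $g : Q_2 \to Q_3$. -/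

import Mathlib

open CategoryTheory MonoidalCategory CartesianMonoidalCategory Limits
open scoped MonObj

set_option linter.unusedSectionVars false

universe w v u

namespace AlgSpan

/-! ### Finitary signatures, terms, varieties and their algebras -/

/-- A finitary single-sorted algebraic signature. -/
structure Signature where
  Op : Type w
  arity : Op → ℕ

/-- Terms over a signature in `n` variables. -/
inductive Signature.Term (S : Signature.{w}) (n : ℕ) : Type w
  | var (i : Fin n) : Signature.Term S n
  | app (σ : S.Op) (ts : Fin (S.arity σ) → Signature.Term S n) : Signature.Term S n

/-- A presentation `(Σ, E)` of a variety: a signature together with a set of equations between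
terms in finitely many variables. -/
structure Variety where
  sig : Signature.{w}
  eqns : ∀ n : ℕ, Set (sig.Term n × sig.Term n)

section Algebras

variable {E : Type u} [Category.{v} E] [HasFiniteProducts E]

variable (E) in
/-- An interpretation of the operations of `S` in `E`: an object `A` with morphisms
`σ : A ^ n ⟶ A` for each `n`-ary operation symbol. -/
structure SigAlgebra (S : Signature.{w}) where
  carrier : E
  op : ∀ σ : S.Op, (∏ᶜ fun _ : Fin (S.arity σ) => carrier) ⟶ carrier

namespace SigAlgebra

variable {S : Signature.{w}}

/-- `σ(x₁, ..., xₙ)` for generalized elements `xᵢ : T ⟶ A`. -/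
noncomputable def apply (A : SigAlgebra E S) (σ : S.Op) {T : E}
    (x : Fin (S.arity σ) → (T ⟶ A.carrier)) : T ⟶ A.carrier :=
  Pi.lift x ≫ A.op σ

/-- The value of a term at generalized elements `xᵢ : T ⟶ A`. -/
noncomputable def eval (A : SigAlgebra E S) {n : ℕ} {T : E} (x : Fin n → (T ⟶ A.carrier)) :
    S.Term n → (T ⟶ A.carrier)
  | .var i => x i
  | .app σ ts => A.apply σ fun i => A.eval x (ts i)

lemma comp_apply (A : SigAlgebra E S) (σ : S.Op) {T T' : E} (f : T' ⟶ T)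
    (x : Fin (S.arity σ) → (T ⟶ A.carrier)) :
    f ≫ A.apply σ x = A.apply σ fun i => f ≫ x i := by
  unfold apply
  rw [← Category.assoc]
  congr 1
  ext
  simp

lemma comp_eval (A : SigAlgebra E S) {n : ℕ} {T T' : E} (f : T' ⟶ T)
    (x : Fin n → (T ⟶ A.carrier)) (t : S.Term n) :
    f ≫ A.eval x t = A.eval (fun i => f ≫ x i) t := by
  induction t with
  | var i => rfl
  | app σ ts ih => simp only [eval, comp_apply, ih]

/-- Homomorphisms: morphisms of `E` commuting with all operations. -/
def IsHom (A B : SigAlgebra E S) (f : A.carrier ⟶ B.carrier) : Prop :=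
  ∀ σ : S.Op, A.op σ ≫ f = Limits.Pi.map (fun _ => f) ≫ B.op σ

lemma IsHom.apply_comp {A B : SigAlgebra E S} {f : A.carrier ⟶ B.carrier} (hf : IsHom A B f)
    (σ : S.Op) {T : E} (x : Fin (S.arity σ) → (T ⟶ A.carrier)) :
    A.apply σ x ≫ f = B.apply σ fun i => x i ≫ f := by
  unfold apply
  rw [Category.assoc, hf σ, ← Category.assoc]
  congr 1
  ext
  simp

lemma isHom_of_apply {A B : SigAlgebra E S} {f : A.carrier ⟶ B.carrier}
    (hf : ∀ (σ : S.Op) (T : E) (x : Fin (S.arity σ) → (T ⟶ A.carrier)),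
      A.apply σ x ≫ f = B.apply σ fun i => x i ≫ f) : IsHom A B f := by
  intro σ
  have h := hf σ _ (fun i => Pi.π (fun _ => A.carrier) i)
  have e1 : Pi.lift (fun i => Pi.π (fun _ : Fin (S.arity σ) => A.carrier) i) = 𝟙 _ := by
    ext; simp
  have e2 : Pi.lift (fun i => Pi.π (fun _ : Fin (S.arity σ) => A.carrier) i ≫ f) =
      Limits.Pi.map (fun _ => f) := by
    ext; simp
  simpa only [apply, e1, e2, Category.id_comp] using h

lemma IsHom.eval_comp {A B : SigAlgebra E S} {f : A.carrier ⟶ B.carrier} (hf : IsHom A B f)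
    {n : ℕ} {T : E} (x : Fin n → (T ⟶ A.carrier)) (t : S.Term n) :
    A.eval x t ≫ f = B.eval (fun i => x i ≫ f) t := by
  induction t with
  | var i => rfl
  | app σ ts ih => simp only [eval, hf.apply_comp, ih]

end SigAlgebra

variable (E) in
/-- A `(Σ, E)`-algebra: the two morphisms `A ^ n ⟶ A` interpreting the sides of each equation
coincide. -/
structure Variety.Algebra (V : Variety.{w}) extends SigAlgebra E V.sig where
  sound : ∀ (n : ℕ), ∀ p ∈ V.eqns n,
    toSigAlgebra.eval (fun i => Pi.π (fun _ : Fin n => carrier) i) p.1 =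
      toSigAlgebra.eval (fun i => Pi.π (fun _ : Fin n => carrier) i) p.2

lemma Variety.Algebra.eval_eq {V : Variety.{w}} (A : V.Algebra E) {n : ℕ}
    {p : V.sig.Term n × V.sig.Term n} (hp : p ∈ V.eqns n) {T : E}
    (x : Fin n → (T ⟶ A.carrier)) : A.eval x p.1 = A.eval x p.2 := by
  have h := congrArg (Pi.lift x ≫ ·) (A.sound n p hp)
  simpa [SigAlgebra.comp_eval] using h

end Algebras

section Cartesian

variable {E : Type u} [Category.{v} E] [CartesianMonoidalCategory E] [HasFiniteLimits E]

/-- The product of two algebras, with componentwise operations. -/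
@[reducible]
noncomputable def SigAlgebra.prod {S : Signature.{w}} (A B : SigAlgebra E S) :
    SigAlgebra E S where
  carrier := A.carrier ⊗ B.carrier
  op σ := lift (Limits.Pi.map (fun _ => fst A.carrier B.carrier) ≫ A.op σ)
    (Limits.Pi.map (fun _ => snd A.carrier B.carrier) ≫ B.op σ)

lemma SigAlgebra.isHom_fst {S : Signature.{w}} (A B : SigAlgebra E S) :
    SigAlgebra.IsHom (A.prod B) A (fst A.carrier B.carrier) := fun _ => lift_fst _ _

lemma SigAlgebra.isHom_snd {S : Signature.{w}} (A B : SigAlgebra E S) :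
    SigAlgebra.IsHom (A.prod B) B (snd A.carrier B.carrier) := fun _ => lift_snd _ _

lemma SigAlgebra.apply_fst {S : Signature.{w}} (A B : SigAlgebra E S) (σ : S.Op) {T : E}
    (x : Fin (S.arity σ) → (T ⟶ A.carrier ⊗ B.carrier)) :
    (A.prod B).apply σ x ≫ fst A.carrier B.carrier = A.apply σ fun i => x i ≫ fst _ _ :=
  (SigAlgebra.isHom_fst A B).apply_comp σ x

lemma SigAlgebra.apply_snd {S : Signature.{w}} (A B : SigAlgebra E S) (σ : S.Op) {T : E}
    (x : Fin (S.arity σ) → (T ⟶ A.carrier ⊗ B.carrier)) :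
    (A.prod B).apply σ x ≫ snd A.carrier B.carrier = B.apply σ fun i => x i ≫ snd _ _ :=
  (SigAlgebra.isHom_snd A B).apply_comp σ x

namespace SigAlgebra

variable {S : Signature.{w}} {A B C : SigAlgebra E S}

lemma IsHom.id (A : SigAlgebra E S) : IsHom A A (𝟙 A.carrier) :=
  isHom_of_apply fun σ T x => by simp

lemma IsHom.comp {f : A.carrier ⟶ B.carrier} {g : B.carrier ⟶ C.carrier} (hf : IsHom A B f)
    (hg : IsHom B C g) : IsHom A C (f ≫ g) :=
  isHom_of_apply fun σ T x => by
    rw [← Category.assoc, hf.apply_comp, hg.apply_comp]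
    simp only [Category.assoc]

lemma IsHom.inv {e : A.carrier ≅ B.carrier} (he : IsHom A B e.hom) : IsHom B A e.inv :=
  isHom_of_apply fun σ T x => by
    rw [← cancel_mono e.hom, he.apply_comp]
    simp

/-- A morphism into a product of algebras is a homomorphism if its two components are. -/
lemma isHom_prod {f : C.carrier ⟶ A.carrier ⊗ B.carrier} (h₁ : IsHom C A (f ≫ fst _ _))
    (h₂ : IsHom C B (f ≫ snd _ _)) : IsHom C (A.prod B) f :=
  isHom_of_apply fun σ T x => by
    apply CartesianMonoidalCategory.hom_ext
    · refine Eq.trans ?_ (apply_fst A B σ _).symm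
      rw [Category.assoc, h₁.apply_comp]
      simp only [Category.assoc]
    · refine Eq.trans ?_ (apply_snd A B σ _).symm
      rw [Category.assoc, h₂.apply_comp]
      simp only [Category.assoc]

variable (A B C)

lemma isHom_associator :
    IsHom ((A.prod B).prod C) (A.prod (B.prod C)) (α_ A.carrier B.carrier C.carrier).hom := by
  refine isHom_prod (A := A) (B := B.prod C) ?_ (isHom_prod ?_ ?_)
  · rw [associator_hom_fst]
    exact (isHom_fst (A.prod B) C).comp (isHom_fst A B)
  · rw [Category.assoc, associator_hom_snd_fst]
    exact (isHom_fst (A.prod B) C).comp (isHom_snd A B)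
  · rw [Category.assoc, associator_hom_snd_snd]
    exact isHom_snd (A.prod B) C

lemma isHom_braiding [BraidedCategory E] :
    IsHom (A.prod B) (B.prod A) (β_ A.carrier B.carrier).hom := by
  refine isHom_prod ?_ ?_
  · rw [braiding_hom_fst]
    exact isHom_snd A B
  · rw [braiding_hom_snd]
    exact isHom_fst A B

end SigAlgebra

namespace Variety.Algebra

variable {V : Variety.{w}}

/-- The product of two `(Σ, E)`-algebras. -/
@[reducible]
noncomputable def prod (A B : V.Algebra E) : V.Algebra E where
  toSigAlgebra := A.toSigAlgebra.prod B.toSigAlgebra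
  sound n p hp := by
    apply CartesianMonoidalCategory.hom_ext
    · exact ((SigAlgebra.isHom_fst _ _).eval_comp _ _).trans ((A.eval_eq hp _).trans
        ((SigAlgebra.isHom_fst _ _).eval_comp _ _).symm)
    · exact ((SigAlgebra.isHom_snd _ _).eval_comp _ _).trans ((B.eval_eq hp _).trans
        ((SigAlgebra.isHom_snd _ _).eval_comp _ _).symm)

variable (V E) in
/-- The terminal algebra. -/
@[reducible]
noncomputable def terminal : V.Algebra E where
  carrier := 𝟙_ E
  op _ := toUnit _
  sound _ _ _ := toUnit_unique _ _

end Variety.Algebra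

end Cartesian

/-! ### Internal partially ordered commutative monoids -/

section POCM

variable (E : Type u) [Category.{v} E] [CartesianMonoidalCategory E] [BraidedCategory E]

/-- An internal partially ordered commutative monoid `(Q, ⊗, k, ≤)` in `E`: a commutative monoid
object together with a subobject `≤` of `Q × Q` which is (on generalized elements) a partial order,
and for which the multiplication is monotone. -/
structure POCM where
  carrier : E
  [mon : MonObj carrier]
  [comm : IsCommMonObj carrier]
  le : Subobject (carrier ⊗ carrier)
  le_refl : ∀ {T : E} (a : T ⟶ carrier), le.Factors (lift a a)
  le_trans : ∀ {T : E} (a b c : T ⟶ carrier),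
    le.Factors (lift a b) → le.Factors (lift b c) → le.Factors (lift a c)
  le_antisymm : ∀ {T : E} (a b : T ⟶ carrier),
    le.Factors (lift a b) → le.Factors (lift b a) → a = b
  mul_le_mul : ∀ {T : E} (a b c d : T ⟶ carrier),
    le.Factors (lift a b) → le.Factors (lift c d) →
      le.Factors (lift (lift a c ≫ μ[carrier]) (lift b d ≫ μ[carrier]))

attribute [instance] POCM.mon POCM.comm

variable {E}

/-- `a ≤ b` for generalized elements `a b : T ⟶ Q`. -/
def POCM.Le (Q : POCM E) {T : E} (a b : T ⟶ Q.carrier) : Prop :=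
  Q.le.Factors (lift a b)

/-- Morphisms of internal partially ordered commutative monoids: monotone monoid morphisms. -/
@[ext]
structure POCM.Hom (Q₁ Q₂ : POCM E) where
  hom : Q₁.carrier ⟶ Q₂.carrier
  isMonHom : IsMonHom hom
  monotone : ∀ {T : E} (a b : T ⟶ Q₁.carrier), Q₁.Le a b → Q₂.Le (a ≫ hom) (b ≫ hom)

instance : Category (POCM E) where
  Hom := POCM.Hom
  id Q := ⟨𝟙 _, inferInstance, fun a b h => by simpa using h⟩
  comp f g := ⟨f.hom ≫ g.hom,
    (have := f.isMonHom; have := g.isMonHom; inferInstance),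
    fun a b h => by
      rw [← Category.assoc, ← Category.assoc]
      exact g.monotone _ _ (f.monotone _ _ h)⟩

namespace POCM

variable (Q : POCM E)

lemma Le.refl {T : E} (a : T ⟶ Q.carrier) : Q.Le a a := Q.le_refl a

lemma Le.of_eq {T : E} {a b : T ⟶ Q.carrier} (h : a = b) : Q.Le a b := h ▸ Q.le_refl a

variable {Q}

lemma Le.trans {T : E} {a b c : T ⟶ Q.carrier} (h₁ : Q.Le a b) (h₂ : Q.Le b c) : Q.Le a c :=
  Q.le_trans a b c h₁ h₂

lemma Le.comp {T T' : E} {a b : T ⟶ Q.carrier} (h : Q.Le a b) (f : T' ⟶ T) :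
    Q.Le (f ≫ a) (f ≫ b) := by
  unfold Le at *
  rw [← comp_lift]
  exact Subobject.factors_of_factors_right f h

lemma Le.mul {T : E} {a b c d : T ⟶ Q.carrier} (h₁ : Q.Le a b) (h₂ : Q.Le c d) :
    Q.Le (a * c) (b * d) :=
  Q.mul_le_mul a b c d h₁ h₂

lemma comp_prod {T T' : E} (f : T' ⟶ T) {J : Type*} (s : Finset J) (x : J → (T ⟶ Q.carrier)) :
    f ≫ ∏ i ∈ s, x i = ∏ i ∈ s, f ≫ x i :=
  map_prod (⟨⟨fun g : T ⟶ Q.carrier => f ≫ g, MonObj.comp_one f⟩,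
    fun a b => MonObj.comp_mul f a b⟩ : (T ⟶ Q.carrier) →* (T' ⟶ Q.carrier)) x s

end POCM

end POCM

/-! ### `Q`-spans -/

section Spans

variable {E : Type u} [Category.{v} E] [CartesianMonoidalCategory E] [BraidedCategory E]

/-- A `Q`-span `(X, f, g, χ)` from `A` to `B`. -/
structure QSpan (Q : POCM E) (A B : E) where
  apex : E
  left : apex ⟶ A
  right : apex ⟶ B
  char : apex ⟶ Q.carrier

namespace QSpan

variable {Q : POCM E} {A B C D A' B' C' : E}

/-- Two `Q`-spans are isomorphic if there is an isomorphism of the apices commuting with the legs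
and with the characteristic morphisms. -/
def Iso (s t : QSpan Q A B) : Prop :=
  ∃ e : s.apex ≅ t.apex,
    s.left = e.hom ≫ t.left ∧ s.right = e.hom ≫ t.right ∧ s.char = e.hom ≫ t.char

/-- `s ⊆ t`: there is a monomorphism of apices `m` commuting with the legs such that
`χ₁(x) ≤ χ₂(m(x))`. -/
def Sub (s t : QSpan Q A B) : Prop :=
  ∃ m : s.apex ⟶ t.apex, Mono m ∧
    s.left = m ≫ t.left ∧ s.right = m ≫ t.right ∧ Q.Le s.char (m ≫ t.char)

variable (Q A) in
/-- The identity `Q`-span `(A, 1, 1, χ_k)`, with `χ_k` constant at the unit `k`. -/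
@[reducible]
def id : QSpan Q A A where
  apex := A
  left := 𝟙 A
  right := 𝟙 A
  char := toUnit A ≫ η[Q.carrier]

/-- The graph `(A, 1, f, χ_k)` of a morphism. -/
@[reducible]
def graph (Q : POCM E) (f : A ⟶ B) : QSpan Q A B where
  apex := A
  left := 𝟙 A
  right := f
  char := toUnit A ≫ η[Q.carrier]

/-- Composition by pullback (in diagrammatic order), multiplying the characteristic morphisms. -/
@[reducible]
noncomputable def comp [HasFiniteLimits E] (s : QSpan Q A B) (t : QSpan Q B C) : QSpan Q A C where
  apex := pullback s.right t.left
  left := pullback.fst _ _ ≫ s.left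
  right := pullback.snd _ _ ≫ t.right
  char := lift (pullback.fst s.right t.left) (pullback.snd s.right t.left) ≫
    (s.char ⊗ₘ t.char) ≫ μ[Q.carrier]

/-- The tensor product of `Q`-spans. -/
@[reducible]
def tensor (s : QSpan Q A B) (t : QSpan Q A' B') : QSpan Q (A ⊗ A') (B ⊗ B') where
  apex := s.apex ⊗ t.apex
  left := s.left ⊗ₘ t.left
  right := s.right ⊗ₘ t.right
  char := (s.char ⊗ₘ t.char) ≫ μ[Q.carrier]

/-- Postcomposition of the characteristic morphism with `h`. -/
@[reducible]
def postcomp {Q₁ Q₂ : POCM E} (s : QSpan Q₁ A B) (h : Q₁ ⟶ Q₂) : QSpan Q₂ A B where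
  apex := s.apex
  left := s.left
  right := s.right
  char := s.char ≫ h.hom

lemma Iso.mk' {X Y : E} {f : X ⟶ A} {g : X ⟶ B} {χ : X ⟶ Q.carrier} {f' : Y ⟶ A} {g' : Y ⟶ B}
    {χ' : Y ⟶ Q.carrier} (e : X ≅ Y) (h₁ : f = e.hom ≫ f') (h₂ : g = e.hom ≫ g')
    (h₃ : χ = e.hom ≫ χ') : Iso (Q := Q) ⟨X, f, g, χ⟩ ⟨Y, f', g', χ'⟩ := ⟨e, h₁, h₂, h₃⟩

lemma Sub.mk' {X Y : E} {f : X ⟶ A} {g : X ⟶ B} {χ : X ⟶ Q.carrier} {f' : Y ⟶ A} {g' : Y ⟶ B}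
    {χ' : Y ⟶ Q.carrier} (m : X ⟶ Y) (hm : Mono m) (h₁ : f = m ≫ f') (h₂ : g = m ≫ g')
    (h₃ : Q.Le χ (m ≫ χ')) : Sub (Q := Q) ⟨X, f, g, χ⟩ ⟨Y, f', g', χ'⟩ := ⟨m, hm, h₁, h₂, h₃⟩

lemma lift_mul {T X Y : E} (a : T ⟶ X) (b : T ⟶ Y) (χ : X ⟶ Q.carrier) (ξ : Y ⟶ Q.carrier) :
    lift a b ≫ (χ ⊗ₘ ξ) ≫ μ[Q.carrier] = (a ≫ χ) * (b ≫ ξ) := by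
  change _ = lift _ _ ≫ μ[Q.carrier]
  simp

lemma tensor_mul {X Y : E} (χ : X ⟶ Q.carrier) (ξ : Y ⟶ Q.carrier) :
    (χ ⊗ₘ ξ) ≫ μ[Q.carrier] = (fst X Y ≫ χ) * (snd X Y ≫ ξ) := by
  rw [← lift_mul]
  simp

lemma unit_char (X : E) : toUnit X ≫ η[Q.carrier] = 1 := rfl

lemma Iso.refl (s : QSpan Q A B) : s.Iso s := ⟨CategoryTheory.Iso.refl _, by simp⟩

lemma Iso.symm {s t : QSpan Q A B} : s.Iso t → t.Iso s := by
  rintro ⟨e, h₁, h₂, h₃⟩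
  exact ⟨e.symm, by simp [h₁], by simp [h₂], by simp [h₃]⟩

lemma Iso.trans {s t r : QSpan Q A B} : s.Iso t → t.Iso r → s.Iso r := by
  rintro ⟨e, h₁, h₂, h₃⟩ ⟨e', h₁', h₂', h₃'⟩
  exact ⟨e ≪≫ e', by simp [h₁, h₁'], by simp [h₂, h₂'], by simp [h₃, h₃']⟩

lemma Iso.sub {s t : QSpan Q A B} : s.Iso t → s.Sub t := by
  rintro ⟨e, h₁, h₂, h₃⟩
  exact ⟨e.hom, inferInstance, h₁, h₂, POCM.Le.of_eq Q h₃⟩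

lemma Sub.trans {s t r : QSpan Q A B} : s.Sub t → t.Sub r → s.Sub r := by
  rintro ⟨m, _, h₁, h₂, h₃⟩ ⟨m', _, h₁', h₂', h₃'⟩
  refine ⟨m ≫ m', mono_comp _ _, by simp [h₁, h₁'], by simp [h₂, h₂'], ?_⟩
  rw [Category.assoc]
  exact h₃.trans (h₃'.comp m)

lemma tensor_iso {s s' : QSpan Q A B} {t t' : QSpan Q A' B'} :
    s.Iso s' → t.Iso t' → (s.tensor t).Iso (s'.tensor t') := by
  rintro ⟨e, h₁, h₂, h₃⟩ ⟨e', h₁', h₂', h₃'⟩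
  refine Iso.mk' (e ⊗ᵢ e') ?_ ?_ ?_
  · simp [h₁, h₁']
  · simp [h₂, h₂']
  · simp [h₃, h₃']

lemma tensor_sub {s s' : QSpan Q A B} {t t' : QSpan Q A' B'} :
    s.Sub s' → t.Sub t' → (s.tensor t).Sub (s'.tensor t') := by
  rintro ⟨m, _, h₁, h₂, h₃⟩ ⟨m', _, h₁', h₂', h₃'⟩
  refine Sub.mk' (m ⊗ₘ m') ⟨fun a b hab => ?_⟩ ?_ ?_ ?_
  · apply CartesianMonoidalCategory.hom_ext
    · rw [← cancel_mono m]
      simpa using congrArg (· ≫ fst _ _) hab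
    · rw [← cancel_mono m']
      simpa using congrArg (· ≫ snd _ _) hab
  · simp [h₁, h₁']
  · simp [h₂, h₂']
  · rw [tensor_mul, tensor_mul, MonObj.comp_mul]
    refine ((h₃.comp _).mul (h₃'.comp _)).trans (POCM.Le.of_eq Q ?_)
    simp

lemma tensor_graph (f : A ⟶ B) (g : A' ⟶ B') :
    ((graph Q f).tensor (graph Q g)).Iso (graph Q (f ⊗ₘ g)) := by
  refine Iso.mk' (CategoryTheory.Iso.refl _) ?_ ?_ ?_
  · simp [graph]
  · simp [graph]
  · dsimp only [graph]
    rw [tensor_mul]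
    simp only [unit_char, MonObj.comp_one, mul_one]

section Limits

variable [HasFiniteLimits E]

attribute [local simp] pullback.lift_fst pullback.lift_snd pullback.lift_fst_assoc
  pullback.lift_snd_assoc

lemma comp_iso {s s' : QSpan Q A B} {t t' : QSpan Q B C} :
    s.Iso s' → t.Iso t' → (s.comp t).Iso (s'.comp t') := by
  rintro ⟨e, h₁, h₂, h₃⟩ ⟨e', h₁', h₂', h₃'⟩
  refine Iso.mk' (asIso (pullback.map s.right t.left s'.right t'.left e.hom e'.hom (𝟙 _)
    (by simp [h₂]) (by simp [h₁']))) ?_ ?_ ?_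
  · simp [h₁]
  · simp [h₂']
  · rw [lift_mul, lift_mul, MonObj.comp_mul]
    simp [h₃, h₃']

lemma comp_sub {s s' : QSpan Q A B} {t t' : QSpan Q B C} :
    s.Sub s' → t.Sub t' → (s.comp t).Sub (s'.comp t') := by
  rintro ⟨m, _, h₁, h₂, h₃⟩ ⟨m', _, h₁', h₂', h₃'⟩
  refine Sub.mk' (pullback.map s.right t.left s'.right t'.left m m' (𝟙 _)
    (by simp [h₂]) (by simp [h₁'])) ⟨fun a b hab => ?_⟩ ?_ ?_ ?_
  · apply pullback.hom_ext
    · rw [← cancel_mono m]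
      simpa using congrArg (· ≫ pullback.fst _ _) hab
    · rw [← cancel_mono m']
      simpa using congrArg (· ≫ pullback.snd _ _) hab
  · simp [h₁]
  · simp [h₂']
  · rw [lift_mul, lift_mul, MonObj.comp_mul]
    refine ((h₃.comp _).mul (h₃'.comp _)).trans (POCM.Le.of_eq Q ?_)
    simp

lemma comp_assoc (s : QSpan Q A B) (t : QSpan Q B C) (r : QSpan Q C D) :
    ((s.comp t).comp r).Iso (s.comp (t.comp r)) := by
  refine Iso.mk' (pullbackAssoc s.right t.left t.right r.left) ?_ ?_ ?_
  · simp [comp]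
  · simp [comp]
  · dsimp only [comp]
    simp only [lift_mul, MonObj.comp_mul, mul_assoc]
    simp

/-- Composition with the graph of a morphism changes the right leg. -/
lemma comp_graph (s : QSpan Q A B) (f : B ⟶ C) :
    (s.comp (graph Q f)).Iso ⟨s.apex, s.left, s.right ≫ f, s.char⟩ := by
  have hc := pullback.condition (f := s.right) (g := 𝟙 B)
  refine Iso.mk' (X := pullback s.right (𝟙 B)) ⟨pullback.fst _ _,
    pullback.lift (𝟙 _) s.right (by simp), ?_, by simp⟩ ?_ ?_ ?_
  · apply pullback.hom_ext
    · simp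
    · simpa using hc
  · simp [graph]
  · simp only [Category.comp_id] at hc
    simp [graph, reassoc_of% hc]
  · dsimp only [graph]
    simp only [lift_mul, unit_char, MonObj.comp_one, mul_one]

/-- Composition with the graph of an isomorphism changes the left leg. -/
lemma graph_comp (e : A ≅ B) (s : QSpan Q B C) :
    ((graph Q e.hom).comp s).Iso ⟨s.apex, s.left ≫ e.inv, s.right, s.char⟩ := by
  have hc := pullback.condition (f := e.hom) (g := s.left)
  have hc' : pullback.fst e.hom s.left = pullback.snd _ _ ≫ s.left ≫ e.inv := by
    rw [← Category.assoc, ← hc]; simp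
  refine Iso.mk' (X := pullback e.hom s.left) ⟨pullback.snd _ _,
    pullback.lift (s.left ≫ e.inv) (𝟙 _) (by simp), ?_, by simp⟩ ?_ ?_ ?_
  · apply pullback.hom_ext
    · simpa using hc'.symm
    · simp
  · simpa [graph] using hc'
  · simp [graph]
  · dsimp only [graph]
    simp only [lift_mul, unit_char, MonObj.comp_one, one_mul]

lemma comp_id (s : QSpan Q A B) : (s.comp (id Q B)).Iso s := by
  have h := comp_graph s (𝟙 B)
  rwa [Category.comp_id] at h

lemma id_comp (s : QSpan Q A B) : ((id Q A).comp s).Iso s := by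
  have h := graph_comp (CategoryTheory.Iso.refl A) s
  rw [CategoryTheory.Iso.refl_inv, Category.comp_id] at h
  exact h

lemma graph_comp_graph (f : A ⟶ B) (g : B ⟶ C) :
    ((graph Q f).comp (graph Q g)).Iso (graph Q (f ≫ g)) := comp_graph _ _

lemma tensor_comp (s : QSpan Q A B) (t : QSpan Q B C) (s' : QSpan Q A' B') (t' : QSpan Q B' C') :
    ((s.tensor s').comp (t.tensor t')).Iso ((s.comp t).tensor (s'.comp t')) := by
  have hc := pullback.condition (f := s.right ⊗ₘ s'.right) (g := t.left ⊗ₘ t'.left)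
  refine Iso.mk' (X := pullback (s.right ⊗ₘ s'.right) (t.left ⊗ₘ t'.left))
    (Y := pullback s.right t.left ⊗ pullback s'.right t'.left) ⟨lift
    (pullback.lift (pullback.fst _ _ ≫ fst _ _) (pullback.snd _ _ ≫ fst _ _)
      (by simpa using congrArg (· ≫ fst _ _) hc))
    (pullback.lift (pullback.fst _ _ ≫ snd _ _) (pullback.snd _ _ ≫ snd _ _)
      (by simpa using congrArg (· ≫ snd _ _) hc)),
    pullback.lift (pullback.fst _ _ ⊗ₘ pullback.fst _ _) (pullback.snd _ _ ⊗ₘ pullback.snd _ _)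
      (by simp only [tensorHom_comp_tensorHom, pullback.condition]), ?_, ?_⟩ ?_ ?_ ?_
  · apply pullback.hom_ext
    · apply CartesianMonoidalCategory.hom_ext
      · simp
      · simp
    · apply CartesianMonoidalCategory.hom_ext
      · simp
      · simp
  · apply CartesianMonoidalCategory.hom_ext
    · apply pullback.hom_ext
      · simp
      · simp
    · apply pullback.hom_ext
      · simp
      · simp
  · apply CartesianMonoidalCategory.hom_ext
    · simp [comp, tensor]
    · simp [comp, tensor]
  · apply CartesianMonoidalCategory.hom_ext
    · simp [comp, tensor]
    · simp [comp, tensor]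
  · dsimp only [comp, tensor]
    simp only [tensor_mul, MonObj.comp_mul]
    rw [mul_mul_mul_comm]
    simp

end Limits

end QSpan

end Spans

/-! ### Preorder-enriched monoidal categories and their functors -/

section Preord

universe v₁ v₂ u₁ u₂

/-- A preordered category: hom-sets are preordered and composition is monotone. -/
class PreordCategory (C : Type u₁) [Category.{v₁} C] where
  homPreorder (X Y : C) : Preorder (X ⟶ Y)
  comp_mono {X Y Z : C} {f f' : X ⟶ Y} {g g' : Y ⟶ Z} :
    f ≤ f' → g ≤ g' → f ≫ g ≤ f' ≫ g'

instance {C : Type u₁} [Category.{v₁} C] [PreordCategory C] (X Y : C) : Preorder (X ⟶ Y) :=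
  PreordCategory.homPreorder X Y

/-- A preordered monoidal category: moreover the tensor product of morphisms is monotone. -/
class PreordMonoidalCategory (C : Type u₁) [Category.{v₁} C] [MonoidalCategory C] extends
    PreordCategory C where
  tensor_mono {X Y X' Y' : C} {f f' : X ⟶ Y} {g g' : X' ⟶ Y'} :
    f ≤ f' → g ≤ g' → (f ⊗ₘ g) ≤ (f' ⊗ₘ g')

/-- A `Preord`-functor is a functor which is monotone on hom-sets. -/
def IsPreordFunctor {C : Type u₁} [Category.{v₁} C] [PreordCategory C] {D : Type u₂}
    [Category.{v₂} D] [PreordCategory D] (F : C ⥤ D) : Prop :=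
  ∀ ⦃X Y : C⦄ ⦃f g : X ⟶ Y⦄, f ≤ g → F.map f ≤ F.map g

/-- A strict symmetric monoidal functor: a symmetric monoidal functor which preserves the unit and
tensor products on the nose, and whose structure morphisms are identities. -/
def IsStrictSymmetricMonoidal {C : Type u₁} [Category.{v₁} C] [MonoidalCategory C]
    [SymmetricCategory C] {D : Type u₂} [Category.{v₂} D] [MonoidalCategory D]
    [SymmetricCategory D] (F : C ⥤ D) : Prop :=
  ∃ (_ : F.Braided) (hε : 𝟙_ D = F.obj (𝟙_ C))
    (hμ : ∀ X Y : C, F.obj X ⊗ F.obj Y = F.obj (X ⊗ Y)),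
    Functor.LaxMonoidal.ε F = eqToHom hε ∧
      ∀ X Y : C, Functor.LaxMonoidal.μ F X Y = eqToHom (hμ X Y)

end Preord

/-! ### The category of algebras and algebraic `Q`-spans -/

section AlgebraicSpans

variable {E : Type u} [Category.{v} E] [CartesianMonoidalCategory E] [BraidedCategory E]
  [HasFiniteLimits E]

/-- A `Q`-span between algebras is algebraic if, in the internal language, for all operations `σ`
and all `xᵢ, aᵢ, bᵢ` with `f(xᵢ) = aᵢ` and `g(xᵢ) = bᵢ`, there exists `y` such that
`f(y) = σ(a₁, ..., aₙ)`, `g(y) = σ(b₁, ..., bₙ)` and `χ(x₁) ⊗ ... ⊗ χ(xₙ) ≤ χ(y)`. This is spelled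
out by the Kripke-Joyal semantics: the `xᵢ, aᵢ, bᵢ` are generalized elements at an arbitrary
stage `T`, and the existential quantifier provides a witness `y` on a cover `T' ↠ T`. -/
def QSpan.IsAlgebraic {Q : POCM E} {S : Signature.{w}} (A B : SigAlgebra E S)
    (s : QSpan Q A.carrier B.carrier) : Prop :=
  ∀ (σ : S.Op) (T : E) (x : Fin (S.arity σ) → (T ⟶ s.apex))
    (a : Fin (S.arity σ) → (T ⟶ A.carrier)) (b : Fin (S.arity σ) → (T ⟶ B.carrier)),
    (∀ i, x i ≫ s.left = a i ∧ x i ≫ s.right = b i) →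
      ∃ (T' : E) (e : T' ⟶ T) (y : T' ⟶ s.apex), Epi e ∧
        y ≫ s.left = e ≫ A.apply σ a ∧ y ≫ s.right = e ≫ B.apply σ b ∧
          Q.Le (e ≫ ∏ i, x i ≫ s.char) (y ≫ s.char)

namespace QSpan

variable {Q : POCM E} {S : Signature.{w}} {A B C A' B' : SigAlgebra E S}

lemma IsAlgebraic.of_iso {s t : QSpan Q A.carrier B.carrier} (hs : IsAlgebraic A B s)
    (h : s.Iso t) : IsAlgebraic A B t := by
  obtain ⟨e, h₁, h₂, h₃⟩ := h
  intro σ T x a b hx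
  obtain ⟨T', c, y, hc, hy₁, hy₂, hy₃⟩ := hs σ T (fun i => x i ≫ e.inv) a b
    (fun i => by simpa [h₁, h₂] using hx i)
  refine ⟨T', c, y ≫ e.hom, hc, by simpa [h₁] using hy₁, by simpa [h₂] using hy₂, ?_⟩
  simpa [h₃] using hy₃

lemma isAlgebraic_graph {f : A.carrier ⟶ B.carrier} (hf : SigAlgebra.IsHom A B f) :
    IsAlgebraic A B (graph Q f) := by
  intro σ T x a b hx
  refine ⟨T, 𝟙 T, A.apply σ a, inferInstance, ?_, ?_, ?_⟩
  · exact (Category.comp_id _).trans (Category.id_comp _).symm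
  · refine (hf.apply_comp σ a).trans (Eq.trans ?_ (Category.id_comp _).symm)
    congr 1
    funext i
    rw [← (hx i).1, ← (hx i).2]
    exact congrArg (· ≫ f) (Category.comp_id (x i))
  · refine POCM.Le.of_eq Q ?_
    dsimp only [graph]
    simp only [unit_char, MonObj.comp_one, Finset.prod_const_one]

lemma IsAlgebraic.comp {s : QSpan Q A.carrier B.carrier} {t : QSpan Q B.carrier C.carrier}
    (hs : IsAlgebraic A B s) (ht : IsAlgebraic B C t) : IsAlgebraic A C (s.comp t) := by
  intro σ T z a c hz
  have hz₁ : ∀ i, (z i ≫ pullback.fst s.right t.left) ≫ s.left = a i := fun i =>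
    (Category.assoc _ _ _).trans (hz i).1
  have hz₂ : ∀ i, (z i ≫ pullback.snd s.right t.left) ≫ t.right = c i := fun i =>
    (Category.assoc _ _ _).trans (hz i).2
  have hz₃ : ∀ i, (z i ≫ pullback.snd s.right t.left) ≫ t.left =
      (z i ≫ pullback.fst s.right t.left) ≫ s.right := fun i => by
    rw [Category.assoc, Category.assoc, pullback.condition]
  obtain ⟨T₁, e₁, x, he₁, hx₁, hx₂, hx₃⟩ := hs σ T (fun i => z i ≫ pullback.fst s.right t.left)
    a _ (fun i => ⟨hz₁ i, rfl⟩)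
  obtain ⟨T₂, e₂, y, he₂, hy₁, hy₂, hy₃⟩ := ht σ T₁
    (fun i => e₁ ≫ z i ≫ pullback.snd s.right t.left) _ _ (fun i => ⟨rfl, rfl⟩)
  have h : (e₂ ≫ x) ≫ s.right = y ≫ t.left := by
    rw [hy₁, Category.assoc, hx₂, SigAlgebra.comp_apply]
    congr 2
    funext i
    rw [Category.assoc e₁, hz₃ i]
  refine ⟨T₂, e₂ ≫ e₁, pullback.lift (e₂ ≫ x) y h, epi_comp _ _, ?_, ?_, ?_⟩
  · exact (pullback.lift_fst_assoc _ _ _ _).trans (by rw [Category.assoc, hx₁, Category.assoc])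
  · refine (pullback.lift_snd_assoc _ _ _ _).trans ?_
    rw [hy₂, Category.assoc, SigAlgebra.comp_apply (f := e₁)]
    congr 2
    funext i
    rw [← hz₂ i, Category.assoc]
  · have h₁ := (hx₃.comp e₂).mul hy₃
    refine (POCM.Le.of_eq Q ?_).trans (h₁.trans (POCM.Le.of_eq Q ?_))
    · have : ∀ i, z i ≫ (s.comp t).char = (z i ≫ pullback.fst s.right t.left ≫ s.char) *
          (z i ≫ pullback.snd s.right t.left ≫ t.char) := fun i => by
        rw [← MonObj.comp_mul, ← lift_mul]
      simp only [this, Finset.prod_mul_distrib, MonObj.comp_mul, POCM.comp_prod, Category.assoc]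
    · refine Eq.symm ((congrArg (pullback.lift (e₂ ≫ x) y h ≫ ·) (lift_mul
        (pullback.fst s.right t.left) (pullback.snd s.right t.left) s.char t.char)).trans ?_)
      rw [MonObj.comp_mul, pullback.lift_fst_assoc, pullback.lift_snd_assoc, Category.assoc]

lemma IsAlgebraic.tensor {s : QSpan Q A.carrier B.carrier} {t : QSpan Q A'.carrier B'.carrier}
    (hs : IsAlgebraic A B s) (ht : IsAlgebraic A' B' t) :
    IsAlgebraic (A.prod A') (B.prod B') (s.tensor t) := by
  intro σ T z a b hz
  obtain ⟨T₁, e₁, x, he₁, hx₁, hx₂, hx₃⟩ := hs σ T (fun i => z i ≫ fst s.apex t.apex)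
    (fun i => a i ≫ fst _ _) (fun i => b i ≫ fst _ _) (fun i => by
      rw [← (hz i).1, ← (hz i).2]
      simp [QSpan.tensor])
  obtain ⟨T₂, e₂, y, he₂, hy₁, hy₂, hy₃⟩ := ht σ T₁ (fun i => e₁ ≫ z i ≫ snd s.apex t.apex)
    (fun i => e₁ ≫ a i ≫ snd _ _) (fun i => e₁ ≫ b i ≫ snd _ _) (fun i => by
      rw [← (hz i).1, ← (hz i).2]
      simp [QSpan.tensor])
  refine ⟨T₂, e₂ ≫ e₁, lift (e₂ ≫ x) y, epi_comp _ _, ?_, ?_, ?_⟩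
  · refine CartesianMonoidalCategory.hom_ext _ _ ?_ ?_
    · rw [Category.assoc (e₂ ≫ e₁)]
      erw [SigAlgebra.apply_fst]
      simp [QSpan.tensor, hx₁]
    · rw [Category.assoc (e₂ ≫ e₁)]
      erw [SigAlgebra.apply_snd]
      simp [QSpan.tensor, hy₁, SigAlgebra.comp_apply]
  · refine CartesianMonoidalCategory.hom_ext _ _ ?_ ?_
    · rw [Category.assoc (e₂ ≫ e₁)]
      erw [SigAlgebra.apply_fst]
      simp [QSpan.tensor, hx₂]
    · rw [Category.assoc (e₂ ≫ e₁)]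
      erw [SigAlgebra.apply_snd]
      simp [QSpan.tensor, hy₂, SigAlgebra.comp_apply]
  · have h₁ := (hx₃.comp e₂).mul hy₃
    refine (POCM.Le.of_eq Q ?_).trans (h₁.trans (POCM.Le.of_eq Q ?_))
    · have : ∀ i, z i ≫ (s.tensor t).char = (z i ≫ fst s.apex t.apex ≫ s.char) *
          (z i ≫ snd s.apex t.apex ≫ t.char) := fun i => by
        rw [← MonObj.comp_mul, ← tensor_mul]
      simp only [this, Finset.prod_mul_distrib, MonObj.comp_mul, POCM.comp_prod, Category.assoc]
    · refine Eq.symm ((congrArg (lift (e₂ ≫ x) y ≫ ·) (tensor_mul s.char t.char)).trans ?_)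
      rw [MonObj.comp_mul, lift_fst_assoc, lift_snd_assoc, Category.assoc]

end QSpan

/-- The category whose objects are `(Σ, E)`-algebras and whose morphisms are isomorphism classes of
algebraic `Q`-spans. -/
structure SpanCat (V : Variety.{w}) (Q : POCM E) where
  alg : V.Algebra E

namespace SpanCat

variable {V : Variety.{w}} {Q : POCM E}

/-- Isomorphism of `Q`-spans as an equivalence relation on algebraic `Q`-spans. -/
def spanSetoid (A B : SpanCat V Q) :
    Setoid {s : QSpan Q A.alg.carrier B.alg.carrier //
      s.IsAlgebraic A.alg.toSigAlgebra B.alg.toSigAlgebra} where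
  r s t := s.1.Iso t.1
  iseqv := ⟨fun _ => QSpan.Iso.refl _, fun h => h.symm, fun h h' => h.trans h'⟩

/-- The isomorphism class of an algebraic `Q`-span. -/
def classOf {A B : SpanCat V Q} (s : QSpan Q A.alg.carrier B.alg.carrier)
    (hs : s.IsAlgebraic A.alg.toSigAlgebra B.alg.toSigAlgebra) : Quotient (spanSetoid A B) :=
  Quotient.mk _ ⟨s, hs⟩

lemma classOf_eq {A B : SpanCat V Q} {s t : QSpan Q A.alg.carrier B.alg.carrier}
    {hs : s.IsAlgebraic A.alg.toSigAlgebra B.alg.toSigAlgebra}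
    {ht : t.IsAlgebraic A.alg.toSigAlgebra B.alg.toSigAlgebra} (h : s.Iso t) :
    classOf s hs = classOf t ht := Quotient.sound h

noncomputable instance : Category (SpanCat V Q) where
  Hom A B := Quotient (spanSetoid A B)
  id A := classOf (QSpan.id Q A.alg.carrier)
    (QSpan.isAlgebraic_graph (SigAlgebra.IsHom.id A.alg.toSigAlgebra))
  comp := Quotient.map₂ (fun s t => ⟨s.1.comp t.1, s.2.comp t.2⟩)
    (fun _ _ h _ _ h' => QSpan.comp_iso h h')
  id_comp := by
    rintro A B ⟨s, hs⟩
    exact classOf_eq (QSpan.id_comp s)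
  comp_id := by
    rintro A B ⟨s, hs⟩
    exact classOf_eq (QSpan.comp_id s)
  assoc := by
    rintro A B C D ⟨s, hs⟩ ⟨t, ht⟩ ⟨r, hr⟩
    exact classOf_eq (QSpan.comp_assoc s t r)

/-- The morphism represented by an algebraic `Q`-span. -/
def homMk {A B : SpanCat V Q} (s : QSpan Q A.alg.carrier B.alg.carrier)
    (hs : s.IsAlgebraic A.alg.toSigAlgebra B.alg.toSigAlgebra) : A ⟶ B :=
  classOf s hs

lemma homMk_eq {A B : SpanCat V Q} {s t : QSpan Q A.alg.carrier B.alg.carrier}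
    {hs : s.IsAlgebraic A.alg.toSigAlgebra B.alg.toSigAlgebra}
    {ht : t.IsAlgebraic A.alg.toSigAlgebra B.alg.toSigAlgebra} (h : s.Iso t) :
    homMk s hs = homMk t ht := Quotient.sound h

lemma hom_ind {A B : SpanCat V Q} {P : (A ⟶ B) → Prop} (h : ∀ s hs, P (homMk s hs))
    (f : A ⟶ B) : P f := Quotient.ind (fun s => h s.1 s.2) f

lemma homMk_comp {A B C : SpanCat V Q} {s : QSpan Q A.alg.carrier B.alg.carrier}
    {t : QSpan Q B.alg.carrier C.alg.carrier}
    (hs : s.IsAlgebraic A.alg.toSigAlgebra B.alg.toSigAlgebra)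
    (ht : t.IsAlgebraic B.alg.toSigAlgebra C.alg.toSigAlgebra) :
    homMk s hs ≫ homMk t ht = homMk (s.comp t) (hs.comp ht) := rfl

/-- The graph of an algebra homomorphism. -/
def graph {A B : SpanCat V Q} (f : A.alg.carrier ⟶ B.alg.carrier)
    (hf : SigAlgebra.IsHom A.alg.toSigAlgebra B.alg.toSigAlgebra f) : A ⟶ B :=
  homMk (QSpan.graph Q f) (QSpan.isAlgebraic_graph hf)

lemma graph_comp_graph {A B C : SpanCat V Q} {f : A.alg.carrier ⟶ B.alg.carrier}
    {g : B.alg.carrier ⟶ C.alg.carrier}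
    (hf : SigAlgebra.IsHom A.alg.toSigAlgebra B.alg.toSigAlgebra f)
    (hg : SigAlgebra.IsHom B.alg.toSigAlgebra C.alg.toSigAlgebra g) :
    graph (Q := Q) (A := A) (B := B) f hf ≫ graph g hg = graph (f ≫ g) (hf.comp hg) :=
  homMk_eq (QSpan.graph_comp_graph f g)

lemma graph_congr {A B : SpanCat V Q} {f g : A.alg.carrier ⟶ B.alg.carrier}
    {hf : SigAlgebra.IsHom A.alg.toSigAlgebra B.alg.toSigAlgebra f}
    {hg : SigAlgebra.IsHom A.alg.toSigAlgebra B.alg.toSigAlgebra g} (h : f = g) :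
    graph (Q := Q) (A := A) (B := B) f hf = graph g hg := by
  subst h; rfl

lemma graph_id (A : SpanCat V Q) :
    graph (Q := Q) (A := A) (B := A) (𝟙 _) (SigAlgebra.IsHom.id _) = 𝟙 A := rfl

/-- The graph of an isomorphism of algebras. -/
def graphIso {A B : SpanCat V Q} (e : A.alg.carrier ≅ B.alg.carrier)
    (he : SigAlgebra.IsHom A.alg.toSigAlgebra B.alg.toSigAlgebra e.hom) : A ≅ B where
  hom := graph e.hom he
  inv := graph e.inv he.inv
  hom_inv_id := by
    rw [graph_comp_graph, ← graph_id]
    exact graph_congr e.hom_inv_id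
  inv_hom_id := by
    rw [graph_comp_graph, ← graph_id]
    exact graph_congr e.inv_hom_id

/-- The tensor product of morphisms: the tensor product of representing `Q`-spans. -/
noncomputable def tensorHom {A B A' B' : SpanCat V Q} :
    (A ⟶ B) → (A' ⟶ B') →
      ((⟨A.alg.prod A'.alg⟩ : SpanCat V Q) ⟶ (⟨B.alg.prod B'.alg⟩ : SpanCat V Q)) :=
  Quotient.map₂ (fun s t => ⟨s.1.tensor t.1, s.2.tensor t.2⟩)
    (fun _ _ h _ _ h' => QSpan.tensor_iso h h')

/-- The tensor product of objects is the product of algebras, the unit is the terminal algebra, and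
the coherence isomorphisms are the graphs of those of the finite products of `E`. -/
noncomputable instance : MonoidalCategoryStruct (SpanCat V Q) where
  tensorObj A B := ⟨A.alg.prod B.alg⟩
  tensorUnit := ⟨Variety.Algebra.terminal E V⟩
  tensorHom f g := tensorHom f g
  whiskerLeft A _ _ f := tensorHom (𝟙 A) f
  whiskerRight f B := tensorHom f (𝟙 B)
  associator A B C := graphIso (A := ⟨(A.alg.prod B.alg).prod C.alg⟩)
    (B := ⟨A.alg.prod (B.alg.prod C.alg)⟩)
    (α_ A.alg.carrier B.alg.carrier C.alg.carrier) (SigAlgebra.isHom_associator _ _ _)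
  leftUnitor A := graphIso (A := ⟨(Variety.Algebra.terminal E V).prod A.alg⟩) (B := A)
    (λ_ A.alg.carrier) (by rw [leftUnitor_hom]; exact SigAlgebra.isHom_snd _ _)
  rightUnitor A := graphIso (A := ⟨A.alg.prod (Variety.Algebra.terminal E V)⟩) (B := A)
    (ρ_ A.alg.carrier) (by rw [rightUnitor_hom]; exact SigAlgebra.isHom_fst _ _)

lemma homMk_tensor {A B A' B' : SpanCat V Q} {s : QSpan Q A.alg.carrier B.alg.carrier}
    {t : QSpan Q A'.alg.carrier B'.alg.carrier}
    (hs : s.IsAlgebraic A.alg.toSigAlgebra B.alg.toSigAlgebra)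
    (ht : t.IsAlgebraic A'.alg.toSigAlgebra B'.alg.toSigAlgebra) :
    homMk s hs ⊗ₘ homMk t ht =
      homMk (A := A ⊗ A') (B := B ⊗ B') (s.tensor t) (hs.tensor ht) := rfl

lemma isHom_tensor {A B A' B' : SpanCat V Q} {f : A.alg.carrier ⟶ B.alg.carrier}
    {g : A'.alg.carrier ⟶ B'.alg.carrier}
    (hf : SigAlgebra.IsHom A.alg.toSigAlgebra B.alg.toSigAlgebra f)
    (hg : SigAlgebra.IsHom A'.alg.toSigAlgebra B'.alg.toSigAlgebra g) :
    SigAlgebra.IsHom (A ⊗ A').alg.toSigAlgebra (B ⊗ B').alg.toSigAlgebra (f ⊗ₘ g) := by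
  refine SigAlgebra.isHom_prod ?_ ?_
  · rw [tensorHom_fst]
    exact (SigAlgebra.isHom_fst _ _).comp hf
  · rw [tensorHom_snd]
    exact (SigAlgebra.isHom_snd _ _).comp hg

lemma graph_tensor {A B A' B' : SpanCat V Q} {f : A.alg.carrier ⟶ B.alg.carrier}
    {g : A'.alg.carrier ⟶ B'.alg.carrier}
    (hf : SigAlgebra.IsHom A.alg.toSigAlgebra B.alg.toSigAlgebra f)
    (hg : SigAlgebra.IsHom A'.alg.toSigAlgebra B'.alg.toSigAlgebra g) :
    (graph f hf ⊗ₘ graph g hg : A ⊗ A' ⟶ B ⊗ B') =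
      graph (A := A ⊗ A') (B := B ⊗ B') (f ⊗ₘ g) (isHom_tensor hf hg) :=
  homMk_eq (QSpan.tensor_graph f g)

/-- The morphism `φ` is the graph of the homomorphism `f`. -/
def IsGraph {A B : SpanCat V Q} (φ : A ⟶ B) (f : A.alg.carrier ⟶ B.alg.carrier) : Prop :=
  ∃ hf : SigAlgebra.IsHom A.alg.toSigAlgebra B.alg.toSigAlgebra f, φ = graph f hf

namespace IsGraph

lemma id (A : SpanCat V Q) : IsGraph (𝟙 A) (𝟙 A.alg.carrier) := ⟨SigAlgebra.IsHom.id _, rfl⟩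

lemma comp {A B C : SpanCat V Q} {φ : A ⟶ B} {ψ : B ⟶ C} {f : A.alg.carrier ⟶ B.alg.carrier}
    {g : B.alg.carrier ⟶ C.alg.carrier} : IsGraph φ f → IsGraph ψ g → IsGraph (φ ≫ ψ) (f ≫ g) := by
  rintro ⟨hf, rfl⟩ ⟨hg, rfl⟩
  exact ⟨hf.comp hg, graph_comp_graph hf hg⟩

lemma tensor {A B A' B' : SpanCat V Q} {φ : A ⟶ B} {ψ : A' ⟶ B'}
    {f : A.alg.carrier ⟶ B.alg.carrier} {g : A'.alg.carrier ⟶ B'.alg.carrier} :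
    IsGraph φ f → IsGraph ψ g → IsGraph (φ ⊗ₘ ψ) (f ⊗ₘ g) := by
  rintro ⟨hf, rfl⟩ ⟨hg, rfl⟩
  exact ⟨isHom_tensor hf hg, graph_tensor hf hg⟩

lemma eq {A B : SpanCat V Q} {φ ψ : A ⟶ B} {f g : A.alg.carrier ⟶ B.alg.carrier} :
    IsGraph φ f → IsGraph ψ g → f = g → φ = ψ := by
  rintro ⟨hf, rfl⟩ ⟨hg, rfl⟩ rfl
  rfl

lemma hom {A B : SpanCat V Q} (e : A.alg.carrier ≅ B.alg.carrier)
    (he : SigAlgebra.IsHom A.alg.toSigAlgebra B.alg.toSigAlgebra e.hom) :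
    IsGraph (graphIso e he).hom e.hom := ⟨he, rfl⟩

lemma inv {A B : SpanCat V Q} (e : A.alg.carrier ≅ B.alg.carrier)
    (he : SigAlgebra.IsHom A.alg.toSigAlgebra B.alg.toSigAlgebra e.hom) :
    IsGraph (graphIso e he).inv e.inv := ⟨he.inv, rfl⟩

lemma associator (A B C : SpanCat V Q) :
    IsGraph (α_ A B C).hom (α_ A.alg.carrier B.alg.carrier C.alg.carrier).hom :=
  ⟨SigAlgebra.isHom_associator _ _ _, rfl⟩

lemma associator_inv (A B C : SpanCat V Q) :
    IsGraph (α_ A B C).inv (α_ A.alg.carrier B.alg.carrier C.alg.carrier).inv :=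
  ⟨(SigAlgebra.isHom_associator _ _ _).inv, rfl⟩

lemma leftUnitor (A : SpanCat V Q) : IsGraph (λ_ A).hom (λ_ A.alg.carrier).hom :=
  ⟨by rw [leftUnitor_hom]; exact SigAlgebra.isHom_snd _ _, rfl⟩

lemma rightUnitor (A : SpanCat V Q) : IsGraph (ρ_ A).hom (ρ_ A.alg.carrier).hom :=
  ⟨by rw [rightUnitor_hom]; exact SigAlgebra.isHom_fst _ _, rfl⟩

/-- Naturality of graphs of isomorphisms follows from an isomorphism of representing spans. -/
lemma naturality {A A' B B' : SpanCat V Q} (s : QSpan Q A.alg.carrier B.alg.carrier)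
    (t : QSpan Q A'.alg.carrier B'.alg.carrier)
    {hs : s.IsAlgebraic A.alg.toSigAlgebra B.alg.toSigAlgebra}
    {ht : t.IsAlgebraic A'.alg.toSigAlgebra B'.alg.toSigAlgebra}
    {φ : A ⟶ A'} {ψ : B ⟶ B'}
    {e : A.alg.carrier ≅ A'.alg.carrier} {e' : B.alg.carrier ≅ B'.alg.carrier}
    (hφ : IsGraph φ e.hom) (hψ : IsGraph ψ e'.hom)
    (i : s.apex ≅ t.apex) (h₁ : s.left ≫ e.hom = i.hom ≫ t.left)
    (h₂ : s.right ≫ e'.hom = i.hom ≫ t.right) (h₃ : s.char = i.hom ≫ t.char) :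
    homMk s hs ≫ ψ = φ ≫ homMk t ht := by
  obtain ⟨he, rfl⟩ := hφ
  obtain ⟨he', rfl⟩ := hψ
  refine homMk_eq ((QSpan.comp_graph s e'.hom).trans (QSpan.Iso.trans ?_
    (QSpan.graph_comp e t).symm))
  refine QSpan.Iso.mk' i ?_ h₂ h₃
  rw [← Category.assoc, ← h₁]
  simp

end IsGraph

noncomputable instance : MonoidalCategory (SpanCat V Q) :=
  MonoidalCategory.ofTensorHom
    (id_tensorHom_id := fun A B =>
      ((IsGraph.id A).tensor (IsGraph.id B)).eq (IsGraph.id (A ⊗ B)) (id_tensorHom_id _ _))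
    (id_tensorHom := fun _ _ _ _ => rfl)
    (tensorHom_id := fun _ _ => rfl)
    (tensorHom_comp_tensorHom := fun f₁ f₂ g₁ g₂ => by
      induction f₁ using hom_ind with | _ s₁ hs₁
      induction f₂ using hom_ind with | _ s₂ hs₂
      induction g₁ using hom_ind with | _ t₁ ht₁
      induction g₂ using hom_ind with | _ t₂ ht₂
      exact homMk_eq (QSpan.tensor_comp s₁ t₁ s₂ t₂))
    (associator_naturality := fun {A₁ A₂ A₃ B₁ B₂ B₃} f₁ f₂ f₃ => by
      induction f₁ using hom_ind with | _ s₁ hs₁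
      induction f₂ using hom_ind with | _ s₂ hs₂
      induction f₃ using hom_ind with | _ s₃ hs₃
      refine IsGraph.naturality (A := (A₁ ⊗ A₂) ⊗ A₃) (B := (B₁ ⊗ B₂) ⊗ B₃)
        (A' := A₁ ⊗ A₂ ⊗ A₃) (B' := B₁ ⊗ B₂ ⊗ B₃)
        ((s₁.tensor s₂).tensor s₃) (s₁.tensor (s₂.tensor s₃))
        (IsGraph.associator _ _ _) (IsGraph.associator _ _ _)
        (α_ s₁.apex s₂.apex s₃.apex) ?_ ?_ ?_
      · exact associator_naturality s₁.left s₂.left s₃.left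
      · exact associator_naturality s₁.right s₂.right s₃.right
      · simp only [QSpan.tensor_mul, MonObj.comp_mul, mul_assoc]
        simp)
    (leftUnitor_naturality := fun {A B} f => by
      induction f using hom_ind with | _ s hs
      refine IsGraph.naturality (A := 𝟙_ _ ⊗ A) (B := 𝟙_ _ ⊗ B) (A' := A) (B' := B)
        ((QSpan.id Q (𝟙_ E)).tensor s) s
        (IsGraph.leftUnitor _) (IsGraph.leftUnitor _) (λ_ s.apex) ?_ ?_ ?_
      · exact (congrArg (· ≫ (λ_ _).hom) (id_tensorHom _ _)).trans (leftUnitor_naturality s.left)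
      · exact (congrArg (· ≫ (λ_ _).hom) (id_tensorHom _ _)).trans (leftUnitor_naturality s.right)
      · simp only [QSpan.tensor_mul, QSpan.unit_char, MonObj.comp_one, one_mul]
        simp [leftUnitor_hom])
    (rightUnitor_naturality := fun {A B} f => by
      induction f using hom_ind with | _ s hs
      refine IsGraph.naturality (A := A ⊗ 𝟙_ _) (B := B ⊗ 𝟙_ _) (A' := A) (B' := B)
        (s.tensor (QSpan.id Q (𝟙_ E))) s
        (IsGraph.rightUnitor _) (IsGraph.rightUnitor _) (ρ_ s.apex) ?_ ?_ ?_
      · exact (congrArg (· ≫ (ρ_ _).hom) (tensorHom_id _ _)).trans (rightUnitor_naturality s.left)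
      · exact (congrArg (· ≫ (ρ_ _).hom) (tensorHom_id _ _)).trans (rightUnitor_naturality s.right)
      · simp only [QSpan.tensor_mul, QSpan.unit_char, MonObj.comp_one, mul_one]
        simp [rightUnitor_hom])
    (pentagon := fun A B C D =>
      (((IsGraph.associator A B C).tensor (IsGraph.id D)).comp
        ((IsGraph.associator A (B ⊗ C) D).comp
          ((IsGraph.id A).tensor (IsGraph.associator B C D)))).eq
        ((IsGraph.associator (A ⊗ B) C D).comp (IsGraph.associator A B (C ⊗ D))) (by
          have h := MonoidalCategory.pentagon A.alg.carrier B.alg.carrier C.alg.carrier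
            D.alg.carrier
          rw [← tensorHom_id, ← id_tensorHom] at h
          exact h))
    (triangle := fun A B =>
      ((IsGraph.associator A (𝟙_ _) B).comp
        ((IsGraph.id A).tensor (IsGraph.leftUnitor B))).eq
        ((IsGraph.rightUnitor A).tensor (IsGraph.id B)) (by
          have h := MonoidalCategory.triangle A.alg.carrier B.alg.carrier
          rw [← tensorHom_id, ← id_tensorHom] at h
          exact h))

/-- The isomorphism of algebras `A × B ≅ B × A`, as an isomorphism of `SpanCat V Q`. -/
noncomputable def braid (A B : SpanCat V Q) : A ⊗ B ≅ B ⊗ A :=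
  graphIso (A := A ⊗ B) (B := B ⊗ A) (β_ A.alg.carrier B.alg.carrier)
    (SigAlgebra.isHom_braiding _ _)

lemma IsGraph.braid (A B : SpanCat V Q) :
    IsGraph (SpanCat.braid A B).hom (β_ A.alg.carrier B.alg.carrier).hom :=
  ⟨SigAlgebra.isHom_braiding _ _, rfl⟩

/-- The symmetry is the graph of the symmetry of the finite products of `E`. -/
noncomputable instance : BraidedCategory (SpanCat V Q) where
  braiding A B := braid A B
  braiding_naturality_right A B C f := by
    induction f using hom_ind with | _ s hs
    refine IsGraph.naturality (A := A ⊗ B) (B := A ⊗ C) (A' := B ⊗ A) (B' := C ⊗ A)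
      ((QSpan.id Q A.alg.carrier).tensor s) (s.tensor (QSpan.id Q A.alg.carrier))
      (IsGraph.braid _ _) (IsGraph.braid _ _) (β_ A.alg.carrier s.apex) ?_ ?_ ?_
    · exact BraidedCategory.braiding_naturality (𝟙 A.alg.carrier) s.left
    · exact BraidedCategory.braiding_naturality (𝟙 A.alg.carrier) s.right
    · simp only [QSpan.tensor_mul, QSpan.unit_char, MonObj.comp_one, mul_one, one_mul]
      simp
  braiding_naturality_left {A B} f C := by
    induction f using hom_ind with | _ s hs
    refine IsGraph.naturality (A := A ⊗ C) (B := B ⊗ C) (A' := C ⊗ A) (B' := C ⊗ B)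
      (s.tensor (QSpan.id Q C.alg.carrier)) ((QSpan.id Q C.alg.carrier).tensor s)
      (IsGraph.braid _ _) (IsGraph.braid _ _) (β_ s.apex C.alg.carrier) ?_ ?_ ?_
    · exact BraidedCategory.braiding_naturality s.left (𝟙 C.alg.carrier)
    · exact BraidedCategory.braiding_naturality s.right (𝟙 C.alg.carrier)
    · simp only [QSpan.tensor_mul, QSpan.unit_char, MonObj.comp_one, mul_one, one_mul]
      simp
  hexagon_forward A B C := by
    rw [← tensorHom_id, ← id_tensorHom]
    exact ((IsGraph.associator A B C).comp ((IsGraph.braid A (B ⊗ C)).comp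
      (IsGraph.associator B C A))).eq
        (((IsGraph.braid A B).tensor (IsGraph.id C)).comp ((IsGraph.associator B A C).comp
          ((IsGraph.id B).tensor (IsGraph.braid A C)))) (by
      have h := BraidedCategory.hexagon_forward A.alg.carrier B.alg.carrier C.alg.carrier
      rw [← tensorHom_id, ← id_tensorHom] at h
      exact h)
  hexagon_reverse A B C := by
    rw [← tensorHom_id, ← id_tensorHom]
    exact ((IsGraph.associator_inv A B C).comp ((IsGraph.braid (A ⊗ B) C).comp
      (IsGraph.associator_inv C A B))).eq
        (((IsGraph.id A).tensor (IsGraph.braid B C)).comp ((IsGraph.associator_inv A C B).comp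
          ((IsGraph.braid A C).tensor (IsGraph.id B)))) (by
      have h := BraidedCategory.hexagon_reverse A.alg.carrier B.alg.carrier C.alg.carrier
      rw [← tensorHom_id, ← id_tensorHom] at h
      exact h)

noncomputable instance : SymmetricCategory (SpanCat V Q) where
  symmetry A B := ((IsGraph.braid A B).comp (IsGraph.braid B A)).eq (IsGraph.id (A ⊗ B))
    (SymmetricCategory.symmetry A.alg.carrier B.alg.carrier)

/-- The order on morphisms induced by the order on representing `Q`-spans. -/
def homLE {A B : SpanCat V Q} : (A ⟶ B) → (A ⟶ B) → Prop :=
  Quotient.lift₂ (fun s t => s.1.Sub t.1) (fun _ _ _ _ h h' => propext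
    ⟨fun hs => (h.symm.sub.trans hs).trans h'.sub, fun hs => (h.sub.trans hs).trans h'.symm.sub⟩)

instance : PreordMonoidalCategory (SpanCat V Q) where
  homPreorder A B :=
    { le := homLE
      le_refl := by
        rintro ⟨s, hs⟩
        exact (QSpan.Iso.refl s).sub
      le_trans := by
        rintro ⟨s, hs⟩ ⟨t, ht⟩ ⟨r, hr⟩ h h'
        exact QSpan.Sub.trans h h' }
  comp_mono := by
    rintro A B C ⟨s, hs⟩ ⟨s', hs'⟩ ⟨t, ht⟩ ⟨t', ht'⟩ h h'
    exact QSpan.comp_sub h h'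
  tensor_mono := by
    rintro A B A' B' ⟨s, hs⟩ ⟨s', hs'⟩ ⟨t, ht⟩ ⟨t', ht'⟩ h h'
    exact QSpan.tensor_sub h h'

end SpanCat

end AlgebraicSpans

end AlgSpan

/-! Postcomposition with `h` alters only the characteristic morphism of a span, never its apex or
its legs. Everything in the span category that involves `Q` is written with three ingredients: the
unit `k` (identities, coherence isomorphisms, symmetry), the multiplication (composition, tensor,
the left side of the algebraicity inequality) and the order (algebraicity, the preorder on
morphisms). A monotone monoid morphism respects all three.

In detail, the generalized elements `T ⟶ Q` form a commutative monoid, and `h` induces monoid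
homomorphisms `(T ⟶ Q₁) → (T ⟶ Q₂)`. Characteristics of composites and tensors are products of
restricted characteristics, so `comp_postcomp`, `tensor_postcomp` and `graph_postcomp` hold as
equalities of spans and not merely up to isomorphism: the same pullbacks and products serve for `Q₁`
and `Q₂`. Monotonicity gives `IsAlgebraic.postcomp`, with the original witness on the original
cover, and `Sub.postcomp`, with the original monomorphism.

For the monoidal structure, the comparison morphisms are identities. Each coherence axiom then
equates two graphs of homomorphisms, and a graph is determined by its underlying morphism of `E`,
where the required equation is immediate. Functoriality in `h` is the unit and associativity law for
composing characteristics with `h`. -/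

namespace AlgSpan

section Postcomposition

variable {E : Type u} [Category.{v} E] [CartesianMonoidalCategory E] [BraidedCategory E]

/-! ### Monoid morphisms acting on generalized elements -/

namespace POCM

variable {Q₁ Q₂ Q₃ : POCM E}

/-- The product of generalized elements is by definition their pairing followed by `μ`, so this is
the multiplicativity of `h` seen through Yoneda. -/
lemma mul_comp_hom (h : Q₁ ⟶ Q₂) {T : E} (a b : T ⟶ Q₁.carrier) :
    (a * b) ≫ h.hom = (a ≫ h.hom) * (b ≫ h.hom) := by
  have := h.isMonHom
  change (lift a b ≫ μ[Q₁.carrier]) ≫ h.hom = lift _ _ ≫ μ[Q₂.carrier]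
  rw [Category.assoc, IsMonHom.mul_hom, lift_map_assoc]

lemma one_comp_hom (h : Q₁ ⟶ Q₂) (T : E) :
    (1 : T ⟶ Q₁.carrier) ≫ h.hom = 1 := by
  have := h.isMonHom
  change (toUnit T ≫ η[Q₁.carrier]) ≫ h.hom = toUnit T ≫ η[Q₂.carrier]
  rw [Category.assoc, IsMonHom.one_hom]

/-- Needed for the `n`-fold product in the algebraicity condition; nullary operations use
preservation of the unit. -/
lemma prod_comp_hom (h : Q₁ ⟶ Q₂) {T : E} {J : Type*} (s : Finset J)
    (x : J → (T ⟶ Q₁.carrier)) : (∏ i ∈ s, x i) ≫ h.hom = ∏ i ∈ s, x i ≫ h.hom :=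
  map_prod (⟨⟨fun a : T ⟶ Q₁.carrier => a ≫ h.hom, one_comp_hom h T⟩, mul_comp_hom h⟩ :
    (T ⟶ Q₁.carrier) →* (T ⟶ Q₂.carrier)) x s

end POCM

/-! ### Postcomposition on representing spans -/

namespace QSpan

variable {Q₁ Q₂ Q₃ : POCM E} {A B C A' B' : E}

/-- The same isomorphism of apices works. This makes postcomposition well defined on isomorphism
classes. -/
lemma Iso.postcomp {s t : QSpan Q₁ A B} (h : Q₁ ⟶ Q₂) :
    s.Iso t → (s.postcomp h).Iso (t.postcomp h) := by
  rintro ⟨e, h₁, h₂, h₃⟩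
  exact ⟨e, h₁, h₂, by simp [h₃]⟩

lemma Sub.postcomp {s t : QSpan Q₁ A B} (h : Q₁ ⟶ Q₂) :
    s.Sub t → (s.postcomp h).Sub (t.postcomp h) := by
  rintro ⟨m, hm, h₁, h₂, h₃⟩
  refine ⟨m, hm, h₁, h₂, ?_⟩
  rw [← Category.assoc]
  exact h.monotone _ _ h₃

/-- Graphs carry the constant `k`, which `h` preserves. This covers identities, coherence
isomorphisms and the symmetry at once, since all of them are graphs. -/
lemma graph_postcomp (h : Q₁ ⟶ Q₂) (f : A ⟶ B) : (graph Q₁ f).postcomp h = graph Q₂ f :=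
  congrArg (QSpan.mk A (𝟙 A) f) (POCM.one_comp_hom h A)

/-- The pullback depends only on the legs, so apex and legs agree definitionally and only the
characteristics remain to be compared. -/
lemma comp_postcomp [HasFiniteLimits E] (h : Q₁ ⟶ Q₂) (s : QSpan Q₁ A B) (t : QSpan Q₁ B C) :
    (s.comp t).postcomp h = (s.postcomp h).comp (t.postcomp h) := by
  refine congrArg (QSpan.mk _ _ _) ?_
  dsimp only
  rw [lift_mul, lift_mul, POCM.mul_comp_hom, Category.assoc, Category.assoc]

lemma tensor_postcomp (h : Q₁ ⟶ Q₂) (s : QSpan Q₁ A B) (t : QSpan Q₁ A' B') :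
    (s.tensor t).postcomp h = (s.postcomp h).tensor (t.postcomp h) := by
  refine congrArg (QSpan.mk _ _ _) ?_
  dsimp only
  rw [tensor_mul, tensor_mul, POCM.mul_comp_hom, Category.assoc, Category.assoc]

lemma postcomp_id (s : QSpan Q₁ A B) : s.postcomp (𝟙 Q₁) = s :=
  congrArg (QSpan.mk s.apex s.left s.right) (Category.comp_id s.char)

lemma postcomp_comp (h : Q₁ ⟶ Q₂) (g : Q₂ ⟶ Q₃) (s : QSpan Q₁ A B) :
    s.postcomp (h ≫ g) = (s.postcomp h).postcomp g :=
  congrArg (QSpan.mk s.apex s.left s.right) (Category.assoc s.char h.hom g.hom).symm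

/-- The existential is witnessed by the same `y` over the same cover `e`, because the legs are
unchanged; the inequality is the image under `h` of the old one, with `h` moved inside the product.
-/
lemma IsAlgebraic.postcomp [HasFiniteLimits E] {S : Signature.{w}} {A B : SigAlgebra E S}
    {s : QSpan Q₁ A.carrier B.carrier} (hs : IsAlgebraic A B s) (h : Q₁ ⟶ Q₂) :
    IsAlgebraic A B (s.postcomp h) := by
  intro σ T x a b hx
  obtain ⟨T', e, y, he, hy₁, hy₂, hy₃⟩ := hs σ T x a b hx
  refine ⟨T', e, y, he, hy₁, hy₂, ?_⟩
  have := h.monotone _ _ hy₃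
  simpa only [Category.assoc, POCM.prod_comp_hom] using this

end QSpan

/-! ### The induced strict symmetric monoidal functor -/

namespace SpanCat

variable [HasFiniteLimits E] {V : Variety.{w}} {Q₁ Q₂ Q₃ : POCM E}

lemma homMk_congr {A B : SpanCat V Q₁} {s t : QSpan Q₁ A.alg.carrier B.alg.carrier}
    {hs : s.IsAlgebraic A.alg.toSigAlgebra B.alg.toSigAlgebra}
    {ht : t.IsAlgebraic A.alg.toSigAlgebra B.alg.toSigAlgebra} (h : s = t) :
    homMk s hs = homMk t ht := by
  subst h; rfl

/-- The functor `SpanCat V Q₁ ⥤ SpanCat V Q₂` induced by a morphism `h : Q₁ ⟶ Q₂`: the identity on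
objects, and postcomposition of characteristic morphisms with `h` on morphisms. -/
noncomputable def postcompFunctor (V : Variety.{w}) (h : Q₁ ⟶ Q₂) :
    SpanCat V Q₁ ⥤ SpanCat V Q₂ where
  obj A := ⟨A.alg⟩
  map {A B} := Quotient.map (sa := spanSetoid A B) (sb := spanSetoid (Q := Q₂) ⟨A.alg⟩ ⟨B.alg⟩)
    (fun s => ⟨s.1.postcomp h, s.2.postcomp h⟩)
    (fun _ _ hst => QSpan.Iso.postcomp h hst)
  -- The identity span is definitionally the graph of `𝟙`.
  map_id A := homMk_congr (Q₁ := Q₂) (A := ⟨A.alg⟩) (B := ⟨A.alg⟩) (QSpan.graph_postcomp h _)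
  map_comp {A B C} f g := by
    induction f using hom_ind with | _ s hs
    induction g using hom_ind with | _ t ht
    exact homMk_congr (Q₁ := Q₂) (A := ⟨A.alg⟩) (B := ⟨C.alg⟩) (QSpan.comp_postcomp h s t)

/-- The two sides are comparable without transport because the functor sends `A ⊗ A'` definitionally
to the tensor of the images. -/
lemma postcompFunctor_map_tensor (h : Q₁ ⟶ Q₂) {A B A' B' : SpanCat V Q₁} (f : A ⟶ B)
    (g : A' ⟶ B') : (postcompFunctor V h).map (f ⊗ₘ g) =
      ((postcompFunctor V h).map f ⊗ₘ (postcompFunctor V h).map g :) := by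
  induction f using hom_ind with | _ s hs
  induction g using hom_ind with | _ t ht
  exact homMk_congr (A := ⟨(A ⊗ A').alg⟩) (B := ⟨(B ⊗ B').alg⟩) (QSpan.tensor_postcomp h s t)

/-- The image of the graph of a homomorphism is its graph. -/
lemma IsGraph.map (h : Q₁ ⟶ Q₂) {A B : SpanCat V Q₁} {φ : A ⟶ B}
    {f : A.alg.carrier ⟶ B.alg.carrier} :
    IsGraph φ f → IsGraph ((postcompFunctor V h).map φ) f := by
  rintro ⟨hf, rfl⟩
  exact ⟨hf, homMk_congr (A := ⟨A.alg⟩) (B := ⟨B.alg⟩) (QSpan.graph_postcomp h f)⟩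

/-- The strict monoidal structure on `postcompFunctor V h`. -/
noncomputable instance (h : Q₁ ⟶ Q₂) : (postcompFunctor V h).Monoidal :=
  Functor.CoreMonoidal.toMonoidal
    { εIso := Iso.refl (𝟙_ (SpanCat V Q₂))
      μIso A B := Iso.refl ((postcompFunctor V h).obj A ⊗ (postcompFunctor V h).obj B)
      μIso_hom_natural_left := fun f X => by
        -- With identity comparison maps, naturality says that the functor commutes with whiskering,
        -- which is tensoring with an identity.
        refine (Category.comp_id _).trans (Eq.trans ?_ (Category.id_comp _).symm)
        rw [← tensorHom_id, ← tensorHom_id, postcompFunctor_map_tensor,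
          CategoryTheory.Functor.map_id]
      μIso_hom_natural_right := fun X f => by
        refine (Category.comp_id _).trans (Eq.trans ?_ (Category.id_comp _).symm)
        rw [← id_tensorHom, ← id_tensorHom, postcompFunctor_map_tensor,
          CategoryTheory.Functor.map_id]
      associativity := fun A B C => by
        let F := postcompFunctor V h
        -- Both sides are composites of graphs, so it suffices to compare the underlying morphisms
        -- of `E`; each reduces to the associator of `E` once identities are removed.
        exact (((IsGraph.id (F.obj A ⊗ F.obj B)).tensor (IsGraph.id (F.obj C))).comp
          ((IsGraph.id (F.obj (A ⊗ B) ⊗ F.obj C)).comp ((IsGraph.associator A B C).map h))).eq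
          ((IsGraph.associator (F.obj A) (F.obj B) (F.obj C)).comp
            (((IsGraph.id (F.obj A)).tensor (IsGraph.id (F.obj B ⊗ F.obj C))).comp
              (IsGraph.id (F.obj A ⊗ F.obj (B ⊗ C))))) (by
            rw [id_tensorHom_id, id_tensorHom_id]
            exact (Category.id_comp _).trans ((Category.id_comp _).trans
              ((congrArg _ (Category.id_comp _)).trans (Category.comp_id _)).symm))
      left_unitality := fun A => by
        let F := postcompFunctor V h
        exact (IsGraph.leftUnitor (F.obj A)).eq
          (((IsGraph.id (𝟙_ (SpanCat V Q₂))).tensor (IsGraph.id (F.obj A))).comp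
            ((IsGraph.id (𝟙_ (SpanCat V Q₂) ⊗ F.obj A)).comp
              ((IsGraph.leftUnitor A).map h))) (by
            rw [id_tensorHom_id]
            exact ((Category.id_comp _).trans (Category.id_comp _)).symm)
      right_unitality := fun A => by
        let F := postcompFunctor V h
        exact (IsGraph.rightUnitor (F.obj A)).eq
          (((IsGraph.id (F.obj A)).tensor (IsGraph.id (𝟙_ (SpanCat V Q₂)))).comp
            ((IsGraph.id (F.obj A ⊗ 𝟙_ (SpanCat V Q₂))).comp
              ((IsGraph.rightUnitor A).map h))) (by
            rw [id_tensorHom_id]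
            exact ((Category.id_comp _).trans (Category.id_comp _)).symm) }

/-- Since the comparison maps are identities, the square says that the image of the symmetry is the
symmetry; both are the graph of the braiding of `E`. -/
noncomputable instance (h : Q₁ ⟶ Q₂) : (postcompFunctor V h).Braided where
  braided A B := by
    refine (Category.id_comp _).trans (Eq.trans ?_ (Category.comp_id _).symm)
    exact ((IsGraph.braid A B).map h).eq (IsGraph.braid (Q := Q₂) ⟨A.alg⟩ ⟨B.alg⟩) rfl

/-- The object equalities are definitional, so every `eqToHom` is an identity, exactly as the
structure morphisms were chosen. -/
lemma isStrictSymmetricMonoidal_postcompFunctor (h : Q₁ ⟶ Q₂) :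
    IsStrictSymmetricMonoidal (postcompFunctor V h) :=
  ⟨inferInstance, rfl, fun _ _ => rfl, rfl, fun _ _ => rfl⟩

lemma isPreordFunctor_postcompFunctor (h : Q₁ ⟶ Q₂) :
    IsPreordFunctor (postcompFunctor V h) := by
  rintro A B ⟨s, hs⟩ ⟨t, ht⟩ hst
  exact QSpan.Sub.postcomp h hst

lemma postcompFunctor_id (Q : POCM E) : postcompFunctor V (𝟙 Q) = 𝟭 (SpanCat V Q) := by
  refine CategoryTheory.Functor.ext (fun _ => rfl) fun A B f => ?_
  induction f using hom_ind with | _ s hs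
  -- Functor extensionality inserts an `eqToHom` on each side; both are identities because `⟨A.alg⟩`
  -- is `A` by structure eta.
  refine Eq.trans ?_ ((Category.id_comp _).trans (Category.comp_id _)).symm
  exact homMk_congr (A := A) (B := B) (QSpan.postcomp_id s)

lemma postcompFunctor_comp (h : Q₁ ⟶ Q₂) (g : Q₂ ⟶ Q₃) :
    postcompFunctor V (h ≫ g) = postcompFunctor V h ⋙ postcompFunctor V g := by
  refine CategoryTheory.Functor.ext (fun _ => rfl) fun A B f => ?_
  induction f using hom_ind with | _ s hs
  refine Eq.trans ?_ ((Category.id_comp _).trans (Category.comp_id _)).symm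
  exact homMk_congr (A := ⟨A.alg⟩) (B := ⟨B.alg⟩) (QSpan.postcomp_comp h g s)

end SpanCat

end Postcomposition

end AlgSpan

/-! ### The main theorem -/

theorem mainTheorem6 {E : Type u} [CategoryTheory.Category.{v} E]
    [CartesianMonoidalCategory E] [BraidedCategory E] [HasFiniteLimits E] [MonoidalClosed E]
    [HasSubobjectClassifier E] (V : AlgSpan.Variety.{w}) :
    ∃ star : ∀ {Q₁ Q₂ : AlgSpan.POCM.{v, u} E}, (Q₁ ⟶ Q₂) →
        (AlgSpan.SpanCat V Q₁ ⥤ AlgSpan.SpanCat V Q₂),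
      (∀ {Q₁ Q₂ : AlgSpan.POCM.{v, u} E} (h : Q₁ ⟶ Q₂),
        (∃ obj_eq : ∀ A : AlgSpan.SpanCat V Q₁, (star h).obj A = ⟨A.alg⟩,
          ∀ (A B : AlgSpan.SpanCat V Q₁)
            (s : AlgSpan.QSpan Q₁ A.alg.carrier B.alg.carrier)
            (hs : s.IsAlgebraic A.alg.toSigAlgebra B.alg.toSigAlgebra),
            ∃ hs' : (s.postcomp h).IsAlgebraic A.alg.toSigAlgebra B.alg.toSigAlgebra,
              (star h).map (AlgSpan.SpanCat.homMk s hs) =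
                eqToHom (obj_eq A) ≫
                  (AlgSpan.SpanCat.homMk (s.postcomp h) hs' :
                    (⟨A.alg⟩ : AlgSpan.SpanCat V Q₂) ⟶ ⟨B.alg⟩) ≫
                  eqToHom (obj_eq B).symm) ∧
        AlgSpan.IsStrictSymmetricMonoidal (star h) ∧
        AlgSpan.IsPreordFunctor (star h)) ∧
      (∀ Q : AlgSpan.POCM.{v, u} E, star (𝟙 Q) = 𝟭 (AlgSpan.SpanCat V Q)) ∧
      (∀ {Q₁ Q₂ Q₃ : AlgSpan.POCM.{v, u} E} (h : Q₁ ⟶ Q₂) (g : Q₂ ⟶ Q₃),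
        star (h ≫ g) = star h ⋙ star g) := by
  refine ⟨fun h => AlgSpan.SpanCat.postcompFunctor V h, fun h => ⟨⟨fun _ => rfl, ?_⟩,
    AlgSpan.SpanCat.isStrictSymmetricMonoidal_postcompFunctor h,
    AlgSpan.SpanCat.isPreordFunctor_postcompFunctor h⟩,
    AlgSpan.SpanCat.postcompFunctor_id, AlgSpan.SpanCat.postcompFunctor_comp⟩
  intro A B s hs
  -- The statement conjugates by `eqToHom` because `star` is bound existentially and its action on
  -- objects is known only up to an equality; for `postcompFunctor` that equality is `rfl`, so the
  -- conjugation disappears.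
  exact ⟨hs.postcomp h, ((Category.id_comp _).trans (Category.comp_id _)).symm⟩
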